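/- Let $I=[0,1]$ and let $f:I\to I$ be continuous. Let $\mathcal K(I)$ be the space of all non-empty compact subsets of $I$ with the Hausdorff metric $d_H$, and let $\overline f:\mathcal K(I)\to\mathcal K(I)$, $\overline f(K)=f(K)$, be the induced map. A continuous self-map $g$ of a compact metric space $(X,d)$ is called generically chaotic if the set of its Li–Yorke pairs $$C(g)=\Bigl\{(x,y)\in X^2:\ \liminf_{n\to\infty} d(g^n(x),g^n(y))=0\ \text{ and }\ \limsup_{n\to\infty} d(g^n(x),g^n(y))>0\Bigr\}$$ is residual in $X^2$, i.e. its complement in $X^2$ is a countable union of nowhere dense sets. If $\overline f$ is generically chaotic (on $(\mathcal K(I),d_H)$), then $f$ is generically chaotic (on $I$ with the usual metric). -/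

import Mathlib

open Filter TopologicalSpace

namespace HyperChaos

noncomputable section

/-- The pairs `(x, y)` whose orbits satisfy `liminf d(fⁿ x, fⁿ y) = 0`. The space is compact, so
the sequence of distances is bounded and the real `liminf` is the genuine one. -/
def C₁ {X : Type*} [MetricSpace X] [CompactSpace X] (f : C(X, X)) : Set (X × X) :=
  {p | liminf (fun n : ℕ => dist (f^[n] p.1) (f^[n] p.2)) atTop = 0}

/-- The pairs `(x, y)` whose orbits satisfy `limsup d(fⁿ x, fⁿ y) > 0`. -/
def C₂ {X : Type*} [MetricSpace X] [CompactSpace X] (f : C(X, X)) : Set (X × X) :=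
  {p | 0 < limsup (fun n : ℕ => dist (f^[n] p.1) (f^[n] p.2)) atTop}

/-- The set of Li–Yorke pairs of `f`. -/
def liYorkePairs {X : Type*} [MetricSpace X] [CompactSpace X] (f : C(X, X)) : Set (X × X) :=
  C₁ f ∩ C₂ f

/-- `f` is generically chaotic if its Li–Yorke pairs form a residual subset of `X × X`
(a set whose complement is of first category). -/
def GenericallyChaotic {X : Type*} [MetricSpace X] [CompactSpace X] (f : C(X, X)) : Prop :=
  liYorkePairs f ∈ residual (X × X)

/-- The map `K ↦ f(K)` induced by `f` on the hyperspace of nonempty compact subsets of `X`. The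
hyperspace carries Mathlib's Hausdorff metric, whose topology is the Vietoris topology. -/
def inducedMap {X : Type*} [MetricSpace X] [CompactSpace X] (f : C(X, X)) :
    C(NonemptyCompacts X, NonemptyCompacts X) where
  toFun K := K.map f f.continuous
  continuous_toFun := f.continuous.nonemptyCompacts_map

end

end HyperChaos

/-!
Write `K × L ⊆ A` as "the box `(K, L)` lies in `A`". Finite sets are dense in the hyperspace, and
a pair of finite sets can be moved into general position, so the boxes lying in a dense open set
form a dense open set of pairs; hence generic boxes lie in any given residual set. Since a set `A`
with the Baire property is comeagre in some nonempty open set or meagre, it is meagre as soon as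
generic boxes do not lie in it.

The pairs that are not Li–Yorke are, up to a meagre set, pairs whose orbits stay `ε` apart from some
time on, or pairs all of whose neighbours have orbits eventually `ε`-close, for every `ε`. A box of
the first kind has images that stay `ε` apart, and a box of the second kind has asymptotic images,
by compactness. Generic boxes therefore lie in neither set.
-/

open Set Topology

namespace HyperChaos

section Category

variable {Z : Type*} [TopologicalSpace Z]

theorem dense_iInter_of_isOpen_of_finite {ι : Type*} [Finite ι] {s : ι → Set Z}
    (ho : ∀ i, IsOpen (s i)) (hd : ∀ i, Dense (s i)) : Dense (⋂ i, s i) := by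
  have := Fintype.ofFinite ι
  suffices h : ∀ t : Finset ι, Dense (⋂ i ∈ t, s i) by simpa using h Finset.univ
  intro t
  induction t using Finset.cons_induction with
  | empty => simp
  | cons i t _ ih =>
    simp only [Finset.mem_cons, iInter_iInter_eq_or_left]
    exact (hd i).inter_of_isOpen_left ih (ho i)

theorem interior_residualEq {s : Set Z} (hs : IsClosed s) :
    interior s =ᶠ[residual Z] s := by
  simpa only [← interior_eq_compl_closure_compl, compl_compl] using
    (closure_residualEq hs.isOpen_compl.isLocallyClosed).compl

end Category

section Boxes

variable {X Y : Type*} [TopologicalSpace X] [TopologicalSpace Y] {A : Set (X × Y)}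

/-- The pairs `(K, L)` of nonempty compact sets whose product `K × L` (a "box") lies in `A`. They
transfer category statements between `X × Y` and the product of the hyperspaces. -/
def boxesIn (A : Set (X × Y)) : Set (NonemptyCompacts X × NonemptyCompacts Y) :=
  {P | (P.1 : Set X) ×ˢ (P.2 : Set Y) ⊆ A}

theorem isOpen_boxesIn (hA : IsOpen A) : IsOpen (boxesIn A) :=
  (NonemptyCompacts.isOpen_subsets_of_isOpen hA).preimage NonemptyCompacts.continuous_prod

theorem boxesIn_nonempty (hA : A.Nonempty) : (boxesIn A).Nonempty := by
  obtain ⟨⟨x, y⟩, hxy⟩ := hA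
  exact ⟨({x}, {y}), by simpa [boxesIn] using hxy⟩

/-- The range of a finite family of points, as an element of the hyperspace. -/
def finiteRange {ι : Type*} [Finite ι] [Nonempty ι] (w : ι → X) : NonemptyCompacts X :=
  ⟨⟨range w, (finite_range w).isCompact⟩, range_nonempty w⟩

attribute [local instance] TopologicalSpace.vietoris in
theorem continuous_finiteRange {ι : Type*} [Finite ι] [Nonempty ι] :
    Continuous (finiteRange : (ι → X) → NonemptyCompacts X) :=
  NonemptyCompacts.isEmbedding_coe.continuous_iff.2 vietoris.continuous_range_of_finite

theorem finiteRange_subtype_val (K : NonemptyCompacts X) [Finite K] [Nonempty K] :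
    finiteRange (Subtype.val : K → X) = K :=
  NonemptyCompacts.ext Subtype.range_coe

theorem dense_setOf_forall_prodMk_mem {ι κ : Type*} [Finite ι] [Finite κ] (hA : IsOpen A)
    (hd : Dense A) : Dense {z : (ι → X) × (κ → Y) | ∀ i j, (z.1 i, z.2 j) ∈ A} := by
  have hDense : Dense (⋂ q : ι × κ, {z : (ι → X) × (κ → Y) | (z.1 q.1, z.2 q.2) ∈ A}) :=
    dense_iInter_of_isOpen_of_finite (fun _ => hA.preimage (by fun_prop)) fun q =>
      hd.preimage ((isOpenMap_eval q.1).prodMap (isOpenMap_eval q.2))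
  exact hDense.mono fun z hz i j => mem_iInter.1 hz (i, j)

theorem dense_boxesIn (hA : IsOpen A) (hd : Dense A) : Dense (boxesIn A) := by
  rw [← dense_closure]
  refine (NonemptyCompacts.dense_setOfPred_finite.prod
    NonemptyCompacts.dense_setOfPred_finite).mono ?_
  rintro ⟨K, L⟩ ⟨hK, hL⟩
  have : Finite K := hK
  have : Finite L := hL
  have : Nonempty K := K.nonempty.to_subtype
  have : Nonempty L := L.nonempty.to_subtype
  have hmaps : MapsTo (Prod.map finiteRange finiteRange)
      {z : (K → X) × (L → Y) | ∀ i j, (z.1 i, z.2 j) ∈ A} (boxesIn A) := by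
    rintro z hz ⟨_, _⟩ ⟨⟨i, rfl⟩, ⟨j, rfl⟩⟩
    exact hz i j
  have hmem := map_mem_closure (continuous_finiteRange.prodMap continuous_finiteRange)
    (dense_setOf_forall_prodMk_mem hA hd (Subtype.val, Subtype.val)) hmaps
  rwa [Prod.map_apply, finiteRange_subtype_val, finiteRange_subtype_val] at hmem

theorem boxesIn_mem_residual (hA : A ∈ residual (X × Y)) :
    boxesIn A ∈ residual (NonemptyCompacts X × NonemptyCompacts Y) := by
  obtain ⟨S, hSopen, hSdense, hScount, hSA⟩ := mem_residual_iff.1 hA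
  have hS : ∀ U ∈ S, boxesIn U ∈ residual (NonemptyCompacts X × NonemptyCompacts Y) := fun U hU =>
    residual_of_dense_open (isOpen_boxesIn (hSopen U hU))
      (dense_boxesIn (hSopen U hU) (hSdense U hU))
  refine mem_of_superset ((countable_bInter_mem hScount).2 hS) fun P hP => ?_
  exact (subset_sInter fun U hU => mem_iInter₂.1 hP U hU).trans hSA

theorem isMeagre_of_isMeagre_boxesIn [BaireSpace (NonemptyCompacts X × NonemptyCompacts Y)]
    (hA : BaireMeasurableSet A) (h : IsMeagre (boxesIn A)) : IsMeagre A := by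
  obtain ⟨U, hU, hAU⟩ := hA.residualEq_isOpen
  obtain rfl | hne := U.eq_empty_or_nonempty
  · exact eventuallyEq_empty.1 hAU
  · have hUA : {p | p ∈ U → p ∈ A} ∈ residual (X × Y) := hAU.symm.le
    obtain ⟨P, hPU, hPA, hP⟩ := (dense_of_mem_residual
      (inter_mem (boxesIn_mem_residual hUA) h)).inter_open_nonempty _ (isOpen_boxesIn hU)
        (boxesIn_nonempty hne)
    exact absurd (fun p hp => hPA hp (hPU hp)) hP

end Boxes

section HausdorffDistance

variable {X : Type*} [MetricSpace X] {K L : NonemptyCompacts X} {ε : ℝ}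

theorem dist_le_of_forall_mem_dist_le (h : ∀ x ∈ K, ∀ y ∈ L, dist x y ≤ ε) : dist K L ≤ ε := by
  obtain ⟨x₀, hx₀⟩ := K.nonempty
  obtain ⟨y₀, hy₀⟩ := L.nonempty
  exact Metric.hausdorffDist_le_of_mem_dist (dist_nonneg.trans (h x₀ hx₀ y₀ hy₀))
    (fun x hx => ⟨y₀, hy₀, h x hx y₀ hy₀⟩)
    (fun y hy => ⟨x₀, hx₀, dist_comm x₀ y ▸ h x₀ hx₀ y hy⟩)

theorem le_dist_of_forall_mem_le_dist (h : ∀ x ∈ K, ∀ y ∈ L, ε ≤ dist x y) : ε ≤ dist K L := by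
  by_contra! hlt
  obtain ⟨x, hx⟩ := K.nonempty
  obtain ⟨y, hy, hxy⟩ := Metric.exists_dist_lt_of_hausdorffDist_lt hx hlt
    (Metric.hausdorffEDist_ne_top_of_nonempty_of_bounded K.nonempty L.nonempty
      K.isCompact.isBounded L.isCompact.isBounded)
  exact (h x hx y hy).not_gt hxy

end HausdorffDistance

section Pairs

variable {X : Type*} [MetricSpace X] (f : C(X, X)) (ε : ℝ) (N : ℕ)

/-- The pairs whose orbits are at distance at most `ε` from time `N` on. -/
def closePairs : Set (X × X) :=
  {p | ∀ n ≥ N, dist (f^[n] p.1) (f^[n] p.2) ≤ ε}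

/-- The pairs whose orbits are at distance at least `ε` from time `N` on. -/
def separatedPairs : Set (X × X) :=
  {p | ∀ n ≥ N, ε ≤ dist (f^[n] p.1) (f^[n] p.2)}

/-- The pairs that have, for every `ε > 0`, a neighbourhood of pairs whose orbits are `ε`-close
from a common time on. As opposed to mere asymptoticity, this holds uniformly on compact sets. The
values `1 / (k + 1)` of `ε` suffice and make the intersection countable. -/
def locallyAsymptoticPairs : Set (X × X) :=
  ⋂ k : ℕ, ⋃ N : ℕ, interior (closePairs f (1 / ((k : ℝ) + 1)) N)

theorem continuous_dist_iterate (n : ℕ) :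
    Continuous fun p : X × X => dist (f^[n] p.1) (f^[n] p.2) :=
  ((f.continuous.iterate n).comp continuous_fst).dist
    ((f.continuous.iterate n).comp continuous_snd)

theorem isBoundedUnder_ge_dist_iterate (p : X × X) :
    IsBoundedUnder (· ≥ ·) atTop fun n : ℕ => dist (f^[n] p.1) (f^[n] p.2) :=
  isBoundedUnder_of ⟨0, fun _ => dist_nonneg⟩

theorem isClosed_closePairs : IsClosed (closePairs f ε N) := by
  simp only [closePairs, ofPred_forall]
  exact isClosed_biInter fun n _ => isClosed_le (continuous_dist_iterate f n) continuous_const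

theorem isClosed_separatedPairs : IsClosed (separatedPairs f ε N) := by
  simp only [separatedPairs, ofPred_forall]
  exact isClosed_biInter fun n _ => isClosed_le continuous_const (continuous_dist_iterate f n)

theorem monotone_closePairs : Monotone (closePairs f ε) :=
  fun _ _ hMN _ hp n hn => hp n (hMN.trans hn)

theorem baireMeasurableSet_locallyAsymptoticPairs :
    BaireMeasurableSet (locallyAsymptoticPairs f) :=
  .iInter fun _ => .iUnion fun _ => isOpen_interior.baireMeasurableSet

theorem locallyAsymptoticPairs_residualEq :
    locallyAsymptoticPairs f =ᶠ[residual (X × X)]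
      (⋂ k : ℕ, ⋃ N : ℕ, closePairs f (1 / ((k : ℝ) + 1)) N : Set (X × X)) :=
  .countable_iInter fun _ => .countable_iUnion fun N =>
    interior_residualEq (isClosed_closePairs f _ N)

end Pairs

section LiYorke

variable {X : Type*} [MetricSpace X] [CompactSpace X] (f : C(X, X))

theorem isBoundedUnder_le_dist_iterate (p : X × X) :
    IsBoundedUnder (· ≤ ·) atTop fun n : ℕ => dist (f^[n] p.1) (f^[n] p.2) :=
  isBoundedUnder_of ⟨Metric.diam (univ : Set X), fun _ =>
    Metric.dist_le_diam_of_mem isCompact_univ.isBounded (mem_univ _) (mem_univ _)⟩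

variable {f} in
theorem mem_C₁_iff {p : X × X} :
    p ∈ C₁ f ↔ ∀ ε > 0, ∃ᶠ n in atTop, dist (f^[n] p.1) (f^[n] p.2) < ε := by
  have hle := isBoundedUnder_le_dist_iterate f p
  have hnonneg : 0 ≤ liminf (fun n : ℕ => dist (f^[n] p.1) (f^[n] p.2)) atTop :=
    le_liminf_of_le hle.isCoboundedUnder_ge (.of_forall fun _ => dist_nonneg)
  exact hnonneg.ge_iff_eq'.symm.trans
    (liminf_le_iff hle.isCoboundedUnder_ge (isBoundedUnder_ge_dist_iterate f p))

variable {f} in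
theorem notMem_C₂_iff {p : X × X} :
    p ∉ C₂ f ↔ ∀ ε > 0, ∀ᶠ n in atTop, dist (f^[n] p.1) (f^[n] p.2) ≤ ε :=
  not_lt.trans (limsup_le_iff' (isBoundedUnder_ge_dist_iterate f p).isCoboundedUnder_le
    (isBoundedUnder_le_dist_iterate f p))

theorem compl_C₁ : (C₁ f)ᶜ = ⋃ (k : ℕ) (N : ℕ), separatedPairs f (1 / ((k : ℝ) + 1)) N := by
  ext p
  simp only [mem_compl_iff, mem_C₁_iff, mem_iUnion]
  push Not
  constructor
  · rintro ⟨ε, hε, hev⟩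
    obtain ⟨k, hk⟩ := exists_nat_one_div_lt hε
    obtain ⟨N, hN⟩ := eventually_atTop.1 hev
    exact ⟨k, N, fun n hn => hk.le.trans (hN n hn)⟩
  · rintro ⟨k, N, hN⟩
    exact ⟨_, Nat.one_div_pos_of_nat, eventually_atTop.2 ⟨N, hN⟩⟩

theorem compl_C₂ : (C₂ f)ᶜ = ⋂ k : ℕ, ⋃ N : ℕ, closePairs f (1 / ((k : ℝ) + 1)) N := by
  ext p
  simp only [mem_compl_iff, notMem_C₂_iff, mem_iInter, mem_iUnion]
  constructor
  · exact fun h k => eventually_atTop.1 (h _ Nat.one_div_pos_of_nat)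
  · intro h ε hε
    obtain ⟨k, hk⟩ := exists_nat_one_div_lt hε
    obtain ⟨N, hN⟩ := h k
    exact eventually_atTop.2 ⟨N, fun n hn => (hN n hn).trans hk.le⟩

variable {f} in
theorem mem_inducedMap_iterate {n : ℕ} {K : NonemptyCompacts X} {y : X} :
    y ∈ (inducedMap f)^[n] K ↔ ∃ x ∈ K, f^[n] x = y := by
  have hsemiconj : Function.Semiconj (fun K : NonemptyCompacts X => (K : Set X))
      (inducedMap f) (image f) := fun _ => rfl
  rw [← SetLike.mem_coe, (hsemiconj.iterate_right n).eq K, ← image_iterate_eq]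
  rfl

theorem boxesIn_closePairs_subset (ε : ℝ) (N : ℕ) :
    boxesIn (closePairs f ε N) ⊆ closePairs (inducedMap f) ε N := by
  intro P hP n hn
  refine dist_le_of_forall_mem_dist_le ?_
  simp only [mem_inducedMap_iterate]
  rintro _ ⟨x, hx, rfl⟩ _ ⟨y, hy, rfl⟩
  exact hP (mk_mem_prod hx hy) n hn

theorem boxesIn_separatedPairs_subset (ε : ℝ) (N : ℕ) :
    boxesIn (separatedPairs f ε N) ⊆ separatedPairs (inducedMap f) ε N := by
  intro P hP n hn
  refine le_dist_of_forall_mem_le_dist ?_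
  simp only [mem_inducedMap_iterate]
  rintro _ ⟨x, hx, rfl⟩ _ ⟨y, hy, rfl⟩
  exact hP (mk_mem_prod hx hy) n hn

theorem boxesIn_locallyAsymptoticPairs_subset :
    boxesIn (locallyAsymptoticPairs f) ⊆ (C₂ (inducedMap f))ᶜ := by
  intro P hP
  rw [compl_C₂]
  refine mem_iInter.2 fun k => ?_
  obtain ⟨N, hN⟩ := (P.1.isCompact.prod P.2.isCompact).elim_directed_cover _
    (fun _ => isOpen_interior) (fun p hp => mem_iInter.1 (hP hp) k)
    (Monotone.directed_le fun _ _ hMN => interior_mono (monotone_closePairs f _ hMN))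
  exact mem_iUnion.2 ⟨N, boxesIn_closePairs_subset f _ N (hN.trans interior_subset)⟩

variable {f}

theorem C₁_mem_residual
    (h : C₁ (inducedMap f) ∈ residual (NonemptyCompacts X × NonemptyCompacts X)) :
    C₁ f ∈ residual (X × X) := by
  rw [← compl_compl (C₁ f), compl_C₁]
  refine isMeagre_iUnion fun k => isMeagre_iUnion fun N => ?_
  have hsub : separatedPairs (inducedMap f) (1 / ((k : ℝ) + 1)) N ⊆ (C₁ (inducedMap f))ᶜ := by
    rw [compl_C₁]
    exact fun P hP => mem_iUnion₂.2 ⟨k, N, hP⟩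
  have hmeagre : IsMeagre (C₁ (inducedMap f))ᶜ := by rwa [IsMeagre, compl_compl]
  exact isMeagre_of_isMeagre_boxesIn
    (isClosed_separatedPairs f _ N).isOpen_compl.baireMeasurableSet.of_compl
    (hmeagre.mono ((boxesIn_separatedPairs_subset f _ N).trans hsub))

theorem C₂_mem_residual
    (h : C₂ (inducedMap f) ∈ residual (NonemptyCompacts X × NonemptyCompacts X)) :
    C₂ f ∈ residual (X × X) := by
  have hmeagre : IsMeagre (locallyAsymptoticPairs f) :=
    isMeagre_of_isMeagre_boxesIn (baireMeasurableSet_locallyAsymptoticPairs f)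
      (mem_of_superset h (subset_compl_comm.1 (boxesIn_locallyAsymptoticPairs_subset f)))
  have heq : locallyAsymptoticPairs f =ᶠ[residual (X × X)] ((C₂ f)ᶜ : Set (X × X)) :=
    compl_C₂ f ▸ locallyAsymptoticPairs_residualEq f
  filter_upwards [hmeagre, heq.mem_iff] with p hp hiff
  exact not_not.1 (mt hiff.2 hp)

end LiYorke

end HyperChaos

open HyperChaos in
theorem theorem2p1_general {X : Type*} [MetricSpace X] [CompactSpace X] (f : C(X, X))
    (hf : GenericallyChaotic (inducedMap f)) : GenericallyChaotic f :=
  inter_mem (C₁_mem_residual (mem_of_superset hf inter_subset_left))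
    (C₂_mem_residual (mem_of_superset hf inter_subset_right))

theorem theorem2p1 (f : C(unitInterval, unitInterval))
    (hf : HyperChaos.GenericallyChaotic (HyperChaos.inducedMap f)) :
    HyperChaos.GenericallyChaotic f := by
  exact theorem2p1_general f hf
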